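/- Let $\mathbb{C}$ be a pointed protomodular category, i.e. a pointed category with finite limits in which the split short five lemma (stated below) holds. A \emph{split extension} with kernel $X$ is a diagram $X \xrightarrow{\kappa} A \underset{\beta}{\overset{\alpha}{\rightleftarrows}} B$ in which $\kappa$ is a kernel of $\alpha$ and $\alpha\beta = 1_B$. A morphism of split extensions from $(X,A,B,\kappa,\alpha,\beta)$ to $(X',A',B',\kappa',\alpha',\beta')$ is a triple $u : X\to X'$, $v : A\to A'$, $w : B\to B'$ with $\kappa' u = v\kappa$, $\beta' w = v\beta$, $\alpha' v = w\alpha$. The split short five lemma says that $v$ is an isomorphism whenever $u$ and $w$ are. A \emph{generic split extension with kernel $X$} is a terminal object $$X \xrightarrow{k} [X]\ltimes X \underset{i}{\overset{p_1}{\rightleftarrows}} [X]$$ in the category of split extensions with kernel $X$ and morphisms of split extensions with $u = 1_X$. When it exists, the \emph{conjugation morphism} $c_X : X\to [X]$ is the component between the base objects of the unique morphism to it, with $u=1_X$, from the split extension $X \xrightarrow{\langle 0,1\rangle} X\times X \underset{\langle 1,1\rangle}{\overset{\pi_1}{\rightleftarrows}} X$. An object $X$ has \emph{trivial center} if its center is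 $0$. Here the center of $X$ is the terminal object in the category of morphisms $g : B\to X$ for which there is $\varphi : X\times B\to X$ with $\varphi\langle 1,0\rangle = 1_X$ and $\varphi\langle 0,1\rangle = g$. An object $Y$ is \emph{strong-complete} if for each kernel $\kappa : Y\to A$ of a split epimorphism there is exactly one $\lambda : A\to Y$ with $\lambda\kappa = 1_Y$. A monomorphism $m : S\to Y$ is \emph{Bourn-normal} if there are an internal equivalence relation $r_1,r_2 : R\to Y$ and a morphism $\tilde m : S\times S\to R$ with $r_j\tilde m = m\pi_j$ for $j=1,2$ such that both of these commutative squares are pullbacks. A morphism $u : S\to Y$ is a \emph{characteristic monomorphism} if for each Bourn-normal monomorphism $n : Y\to Z$ the composite $nu$ is a Bourn-normal monomorphism. \textbf{Theorem.} Let $X$ be an object of $\mathbb{C}$ that admits a generic split extension with kernel $X$. Then the following are equivalent: (a) there is a generic split extension with kernel $[X]$, and the conjugation morphism $c_X : X\to [X]$ is a characteristic monomorphism; (b) $X$ has trivial center and $[X]$ is strong-complete. -/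

import Mathlib

open CategoryTheory CategoryTheory.Limits

universe v u

namespace PointedCat

noncomputable section

variable {C : Type u} [Category.{v} C] [HasZeroMorphisms C]

/-- A split extension `X --κ--> A ⇄ B` with kernel object `X`: `κ` is a kernel of `α` and `β` is a
section of `α`. -/
structure SplitExtension (X : C) where
  /-- the middle object `A` -/
  mid : C
  /-- the base object `B` -/
  base : C
  /-- the kernel inclusion -/
  κ : X ⟶ mid
  /-- the split epimorphism -/
  α : mid ⟶ base
  /-- the chosen section of `α` -/
  β : base ⟶ mid
  section_comp : β ≫ α = 𝟙 base
  κ_comp : κ ≫ α = 0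
  isKernel : Nonempty (IsLimit (KernelFork.ofι κ κ_comp))

/-- A morphism of split extensions `(u, v, w)` whose component `u` between the kernel objects is
prescribed. -/
@[ext]
structure SplitExtension.HomOver {X X' : C} (E : SplitExtension X) (E' : SplitExtension X')
    (u : X ⟶ X') where
  /-- the component `v` between the middle objects -/
  mid : E.mid ⟶ E'.mid
  /-- the component `w` between the base objects -/
  base : E.base ⟶ E'.base
  comm_κ : u ≫ E'.κ = E.κ ≫ mid
  comm_β : base ≫ E'.β = E.β ≫ mid
  comm_α : mid ≫ E'.α = E.α ≫ base

/-- The category of split extensions with kernel object `X`, that is, the fibre over `X` of the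
functor sending a split extension to its kernel object: morphisms are the morphisms of split
extensions with component `𝟙 X` between the kernel objects. -/
instance SplitExtension.category (X : C) : Category (SplitExtension X) where
  Hom E E' := SplitExtension.HomOver E E' (𝟙 X)
  id E :=
    { mid := 𝟙 E.mid
      base := 𝟙 E.base
      comm_κ := by simp
      comm_β := by simp
      comm_α := by simp }
  comp {E F G} f g :=
    { mid := f.mid ≫ g.mid
      base := f.base ≫ g.base
      comm_κ := by
        have h₁ := f.comm_κ
        have h₂ := g.comm_κ
        simp only [Category.id_comp] at h₁ h₂ ⊢
        rw [h₂, h₁, Category.assoc]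
      comm_β := by rw [Category.assoc, g.comm_β, ← Category.assoc, f.comm_β, Category.assoc]
      comm_α := by rw [Category.assoc, g.comm_α, ← Category.assoc, f.comm_α, Category.assoc] }
  id_comp f := SplitExtension.HomOver.ext (Category.id_comp f.mid) (Category.id_comp f.base)
  comp_id f := SplitExtension.HomOver.ext (Category.comp_id f.mid) (Category.comp_id f.base)
  assoc f g h := SplitExtension.HomOver.ext (Category.assoc f.mid g.mid h.mid)
    (Category.assoc f.base g.base h.base)

/-- A generic split extension with kernel `X`: a terminal object of the category of split
extensions with kernel `X`. Its base is the object `[X]`. -/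
abbrev IsGeneric {X : C} (E : SplitExtension X) : Type (max u v) := IsTerminal E

variable (C) in
/-- Protomodularity of a pointed category with finite limits, as the split short five lemma: if
`(u, v, w)` is a morphism of split extensions and `u` and `w` are isomorphisms, so is `v`. -/
class IsProtomodular : Prop where
  isIso_mid : ∀ {X X' : C} {E : SplitExtension X} {E' : SplitExtension X'} {u : X ⟶ X'}
    (f : SplitExtension.HomOver E E' u), IsIso u → IsIso f.base → IsIso f.mid

/-- A protosplit monomorphism: a kernel of a split epimorphism. -/
def IsProtosplitMono {X A : C} (κ : X ⟶ A) : Prop :=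
  ∃ (B : C) (α : A ⟶ B) (w : κ ≫ α = 0),
    IsSplitEpi α ∧ Nonempty (IsLimit (KernelFork.ofι κ w))

/-- `X` is strong-complete if each protosplit monomorphism with domain `X` is a split monomorphism
in a unique way. -/
def IsStrongComplete (X : C) : Prop :=
  ∀ ⦃A : C⦄ (κ : X ⟶ A), IsProtosplitMono κ → ∃! r : A ⟶ X, κ ≫ r = 𝟙 X

section

variable [HasFiniteLimits C]

/-- The split extension `X --⟨0,1⟩--> X ⨯ X ⇄ X`, with split epimorphism the first projection and
with section the diagonal. -/
def conjExtension (X : C) : SplitExtension X where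
  mid := X ⨯ X
  base := X
  κ := prod.lift 0 (𝟙 X)
  α := prod.fst
  β := prod.lift (𝟙 X) (𝟙 X)
  section_comp := prod.lift_fst _ _
  κ_comp := prod.lift_fst _ _
  isKernel := ⟨KernelFork.IsLimit.ofι _ _ (fun g _ => g ≫ prod.snd)
    (fun g hg => by
      rw [prod.comp_lift, comp_zero, Category.comp_id]
      apply prod.hom_ext
      · rw [prod.lift_fst, hg]
      · rw [prod.lift_snd])
    (fun g _ m hm => by rw [← hm, Category.assoc, prod.lift_snd, Category.comp_id])⟩

/-- The conjugation morphism `c_X : X ⟶ [X]`: the base component of the unique morphism of split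
extensions with kernel `X` from `X --⟨0,1⟩--> X ⨯ X ⇄ X` to the generic one. -/
def conj {X : C} {E : SplitExtension X} (hE : IsGeneric E) : X ⟶ E.base :=
  SplitExtension.HomOver.base (hE.from (conjExtension X))

/-- `f` and `g` commute in the sense of Huq. -/
def HuqCommute {A B X : C} (f : A ⟶ X) (g : B ⟶ X) : Prop :=
  ∃ φ : A ⨯ B ⟶ X, prod.lift (𝟙 A) 0 ≫ φ = f ∧ prod.lift 0 (𝟙 B) ≫ φ = g

/-- The full subcategory of `Over X` of the morphisms that commute with `f`; a terminal object of
it is the centralizer of `f`. -/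
abbrev CommutingWith {A X : C} (f : A ⟶ X) : Type (max u v) :=
  ObjectProperty.FullSubcategory (fun g : Over X => HuqCommute f g.hom)

/-- `X` has trivial center: the center of `X`, that is, the centralizer of `𝟙 X`, exists and its
domain is a zero object. -/
def HasTrivialCenter (X : C) : Prop :=
  ∃ z : CommutingWith (𝟙 X), Nonempty (IsTerminal z) ∧ IsZero z.obj.left

/-- `m : S ⟶ X` is a Bourn-normal monomorphism: a monomorphism for which there are an internal
equivalence relation `(R, r₁, r₂)` on `X` and a morphism `S ⨯ S ⟶ R` lying over `m` along both
pairs of projections and making both squares pullbacks. -/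
def IsBournNormalMono {S X : C} (m : S ⟶ X) : Prop :=
  Mono m ∧ ∃ (R : C) (r₁ r₂ : R ⟶ X) (m' : S ⨯ S ⟶ R), IsEquivalenceRelation r₁ r₂ ∧
    IsPullback m' prod.fst r₁ m ∧ IsPullback m' prod.snd r₂ m

/-- `u : S ⟶ X` is a characteristic monomorphism: its composite with each Bourn-normal
monomorphism with domain `X` is a Bourn-normal monomorphism. -/
def IsCharacteristicMono {S X : C} (u : S ⟶ X) : Prop :=
  ∀ ⦃Y : C⦄ (n : X ⟶ Y), IsBournNormalMono n → IsBournNormalMono (u ≫ n)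

end

end

end PointedCat

/-!
Write `Y = [X]` for the base of the generic split extension `E`, and call *classifying morphism* of
a split extension with kernel `X` the base component of its unique morphism to `E`.

The middle object of `E` carries a second projection `p₂` to `Y`, the classifying morphism of the
kernel pair of `p₁ = E.α` (`secondProj`). It measures the effect of a change of section on
classifying morphisms (`classify_changeSection`), and this makes `(p₁, p₂)` reflexive, symmetric and
transitive. The restriction of `p₂` to the kernel is the conjugation morphism `c`. Triviality of the
center amounts to `c` being a monomorphism, and then `(p₁, p₂)` is an equivalence relation on `Y`
whose class of `0` is `c`. Protomodularity enters through the fact that the kernel and the section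
of a split extension factor together through no proper subobject of the middle object. In
particular, for `c` a monomorphism, a split extension `D` with kernel `X` is classified by
`D.β ≫ q` as soon as `q : D.mid ⟶ Y` restricts to `c` on the kernel (`classify_eq_of_κ_comp`).

A monomorphism is Bourn-normal exactly when it is the class of `0` of an equivalence relation
(`isBournNormalMono_iff`), and then that relation is a split extension with the monomorphism as
kernel (`exists_relExtension`).

If `c` is characteristic and `κ : Y ⟶ A` is protosplit, then `κ` is Bourn-normal, hence so is
`c ≫ κ`. The criterion above, applied to the corresponding split extension over `A`, shows that its
classifying morphism is a retraction of `κ`, and that it is the only one.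

Conversely, if `Y` is strong-complete, then `conjExtension Y` is a generic split extension with
kernel `Y`. So if `n : Y ⟶ Z` is the class of `0` of an equivalence relation `R` on `Z`, the morphism
from the split extension of `R` to `conjExtension Y` provides a retraction `w` of `n`. The
intersection of `R` with the inverse image along `w` of the relation `(p₁, p₂)` has `c ≫ n` as its
class of `0`.
-/

namespace PointedCat

open ZeroObject

noncomputable section

variable {C : Type u} [Category.{v} C]

/-! ### Internal relations on generalized elements -/

/-- The relation on the generalized elements `T ⟶ Y` induced by a pair `p₁, p₂ : R ⟶ Y`. -/
def Related {R Y T : C} (p₁ p₂ : R ⟶ Y) (a b : T ⟶ Y) : Prop :=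
  ∃ t : T ⟶ R, t ≫ p₁ = a ∧ t ≫ p₂ = b

theorem IsEquivalenceRelation.equivalence_related {R Y : C} {p₁ p₂ : R ⟶ Y}
    (h : IsEquivalenceRelation p₁ p₂) (T : C) : Equivalence (Related (T := T) p₁ p₂) := by
  obtain ⟨⟨e⟩⟩ := h
  refine ⟨fun a => ⟨a ≫ e.r, by simp [e.reflexivity₁], by simp [e.reflexivity₂]⟩, ?_, ?_⟩
  · rintro a b ⟨t, rfl, rfl⟩
    exact ⟨t ≫ e.s, by simp [e.symmetry₁], by simp [e.symmetry₂]⟩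
  · rintro a b c ⟨t, rfl, h⟩ ⟨t', h', rfl⟩
    have w : t ≫ p₂ = t' ≫ p₁ := h.trans h'.symm
    obtain ⟨l, hl₁, hl₂⟩ : ∃ l, l ≫ e.c.fst = t ∧ l ≫ e.c.snd = t' :=
      ⟨PullbackCone.IsLimit.lift e.isLimit t t' w,
        PullbackCone.IsLimit.lift_fst e.isLimit t t' w,
        PullbackCone.IsLimit.lift_snd e.isLimit t t' w⟩
    refine ⟨l ≫ e.t, ?_, ?_⟩
    · rw [Category.assoc, e.transitivity₁, ← Category.assoc, hl₁]
    · rw [Category.assoc, e.transitivity₂, ← Category.assoc, hl₂]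

theorem IsEquivalenceRelation.hom_ext {R Y T : C} {p₁ p₂ : R ⟶ Y}
    (h : IsEquivalenceRelation p₁ p₂) {f g : T ⟶ R} (h₁ : f ≫ p₁ = g ≫ p₁)
    (h₂ : f ≫ p₂ = g ≫ p₂) : f = g := by
  obtain ⟨⟨e⟩⟩ := h
  exact e.right_cancellation f g h₁ h₂

theorem isEquivalenceRelation_of_equivalence_related [HasPullbacks C] {R Y : C} {p₁ p₂ : R ⟶ Y}
    (hmono : ∀ ⦃T : C⦄ (f g : T ⟶ R), f ≫ p₁ = g ≫ p₁ → f ≫ p₂ = g ≫ p₂ → f = g)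
    (h : ∀ T : C, Equivalence (Related (T := T) p₁ p₂)) : IsEquivalenceRelation p₁ p₂ := by
  choose r hr₁ hr₂ using (h Y).refl (𝟙 Y)
  choose s hs₁ hs₂ using (h R).symm ⟨𝟙 R, rfl, rfl⟩
  choose t ht₁ ht₂ using (h (pullback p₂ p₁)).trans ⟨pullback.fst p₂ p₁, rfl, rfl⟩
    ⟨pullback.snd p₂ p₁, pullback.condition.symm, rfl⟩
  exact ⟨⟨{
    right_cancellation := hmono
    r := r
    reflexivity₁ := hr₁
    reflexivity₂ := hr₂
    s := s
    symmetry₁ := by simpa using hs₁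
    symmetry₂ := by simpa using hs₂
    c := pullback.cone p₂ p₁
    isLimit := pullback.isLimit p₂ p₁
    t := t
    transitivity₁ := ht₁
    transitivity₂ := ht₂ }⟩⟩

variable [HasZeroMorphisms C]

/-! ### Morphisms of split extensions with a fixed kernel -/

namespace SplitExtension

variable {X : C}

instance mono_κ (D : SplitExtension X) : Mono D.κ :=
  ⟨fun _ _ h => Fork.IsLimit.hom_ext D.isKernel.some h⟩

theorem exists_comp_κ_eq (D : SplitExtension X) {T : C} (f : T ⟶ D.mid) (h : f ≫ D.α = 0) :
    ∃ x : T ⟶ X, x ≫ D.κ = f :=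
  ⟨(KernelFork.IsLimit.lift' D.isKernel.some f h).1,
    (KernelFork.IsLimit.lift' D.isKernel.some f h).2⟩

/-- A split extension, with the universal property of the kernel on generalized elements. -/
abbrev mk' {A B : C} (κ : X ⟶ A) (α : A ⟶ B) (β : B ⟶ A) (h : β ≫ α = 𝟙 B) (w : κ ≫ α = 0) [Mono κ]
    (hκ : ∀ ⦃T : C⦄ (f : T ⟶ A), f ≫ α = 0 → ∃ x, x ≫ κ = f) : SplitExtension X where
  mid := A
  base := B
  κ := κ
  α := α
  β := β
  section_comp := h
  κ_comp := w
  isKernel := ⟨KernelFork.IsLimit.ofι _ _ (fun f hf => (hκ f hf).choose)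
    (fun f hf => (hκ f hf).choose_spec)
    (fun f hf m hm => by rw [← cancel_mono κ, hm, (hκ f hf).choose_spec])⟩

/-- The component between the middle objects of a morphism over `X`. -/
def midMap {D D' : SplitExtension X} (f : D ⟶ D') : D.mid ⟶ D'.mid := HomOver.mid f

/-- The component between the base objects of a morphism over `X`. -/
def baseMap {D D' : SplitExtension X} (f : D ⟶ D') : D.base ⟶ D'.base := HomOver.base f

/-- A morphism of split extensions that is the identity of the kernel `X`. -/
def homMk {D D' : SplitExtension X} (v : D.mid ⟶ D'.mid) (w : D.base ⟶ D'.base)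
    (h₁ : D.κ ≫ v = D'.κ) (h₂ : D.β ≫ v = w ≫ D'.β) (h₃ : v ≫ D'.α = D.α ≫ w) : D ⟶ D' :=
  HomOver.mk v w (by rw [Category.id_comp, h₁]) h₂.symm h₃

section

variable {D D' : SplitExtension X} (f : D ⟶ D')

theorem κ_midMap : D.κ ≫ midMap f = D'.κ :=
  (HomOver.comm_κ f).symm.trans (Category.id_comp _)

theorem β_midMap : D.β ≫ midMap f = baseMap f ≫ D'.β := (HomOver.comm_β f).symm

theorem midMap_α : midMap f ≫ D'.α = D.α ≫ baseMap f := HomOver.comm_α f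

end

/-- The split extension with a different section of the same split epimorphism. -/
abbrev changeSection (D : SplitExtension X) (σ : D.base ⟶ D.mid) (hσ : σ ≫ D.α = 𝟙 D.base) :
    SplitExtension X :=
  { D with β := σ, section_comp := hσ }

variable [HasFiniteLimits C]

/-- The pullback of a split extension along a morphism to its base. -/
abbrev pullbackAlong (D : SplitExtension X) {T : C} (b : T ⟶ D.base) : SplitExtension X :=
  have w : D.κ ≫ D.α = 0 ≫ b := by rw [D.κ_comp, zero_comp]
  have : Mono (pullback.lift D.κ 0 w) := by
    have : Mono (pullback.lift D.κ 0 w ≫ pullback.fst D.α b) := by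
      rw [pullback.lift_fst]; infer_instance
    exact mono_of_mono _ (pullback.fst D.α b)
  mk' (pullback.lift D.κ 0 w) (pullback.snd D.α b)
    (pullback.lift (b ≫ D.β) (𝟙 T) (by
      rw [Category.assoc, D.section_comp, Category.comp_id, Category.id_comp]))
    (pullback.lift_snd _ _ _) (pullback.lift_snd _ _ _)
    (fun T f hf => by
      obtain ⟨x, hx⟩ := D.exists_comp_κ_eq (f ≫ pullback.fst D.α b) (by
        rw [Category.assoc, pullback.condition, ← Category.assoc, hf, zero_comp])
      refine ⟨x, pullback.hom_ext ?_ ?_⟩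
      · rw [Category.assoc, pullback.lift_fst, hx]
      · rw [Category.assoc, pullback.lift_snd, hf, comp_zero])

/-- The projection of a pulled back split extension to the original one. -/
def pullbackProj (D : SplitExtension X) {T : C} (b : T ⟶ D.base) : D.pullbackAlong b ⟶ D :=
  homMk (D := D.pullbackAlong b) (pullback.fst D.α b) b (pullback.lift_fst _ _ _)
    (pullback.lift_fst _ _ _) pullback.condition

/-- The kernel pair of the split epimorphism of `D`, with its first projection split by the
diagonal, and with kernel `X`. -/
abbrev kernelPairExtension (D : SplitExtension X) : SplitExtension X :=
  (D.pullbackAlong D.α).changeSection (pullback.lift (𝟙 _) (𝟙 _) rfl) (pullback.lift_snd _ _ _)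

section Protomodular

variable [IsProtomodular C]

omit [HasFiniteLimits C] in
/-- The kernel and the section of a split extension are jointly extremal-epic. -/
theorem isIso_of_mono (D : SplitExtension X) {M : C} (m : M ⟶ D.mid) [Mono m] (k : X ⟶ M)
    (s : D.base ⟶ M) (hk : k ≫ m = D.κ) (hs : s ≫ m = D.β) : IsIso m := by
  have : Mono k := by
    have : Mono (k ≫ m) := hk ▸ inferInstance
    exact mono_of_mono k m
  let D' : SplitExtension X := mk' k (m ≫ D.α) s
    (by rw [← Category.assoc, hs, D.section_comp]) (by rw [← Category.assoc, hk, D.κ_comp])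
    (fun T f hf => by
      obtain ⟨x, hx⟩ := D.exists_comp_κ_eq (f ≫ m) (by rw [Category.assoc, hf])
      exact ⟨x, by rw [← cancel_mono m, Category.assoc, hk, hx]⟩)
  let f : HomOver D' D (𝟙 X) := homMk (D := D') m (𝟙 _) hk
    (hs.trans (Category.id_comp _).symm) (Category.comp_id _).symm
  exact IsProtomodular.isIso_mid f inferInstance (inferInstanceAs (IsIso (𝟙 D.base)))

theorem mid_hom_ext (D : SplitExtension X) {T : C} {f g : D.mid ⟶ T} (hκ : D.κ ≫ f = D.κ ≫ g)
    (hβ : D.β ≫ f = D.β ≫ g) : f = g := by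
  have := D.isIso_of_mono (equalizer.ι f g) (equalizer.lift D.κ hκ) (equalizer.lift D.β hβ)
    (equalizer.lift_ι _ _) (equalizer.lift_ι _ _)
  exact eq_of_epi_equalizer

end Protomodular

end SplitExtension

open SplitExtension

variable [HasFiniteLimits C]

/-- In a pointed protomodular category, a morphism with trivial kernel is a monomorphism: the
kernel pair of `f` is then a split extension with kernel `0`. -/
theorem mono_of_comp_eq_zero [HasZeroObject C] [IsProtomodular C] {A B : C} (f : A ⟶ B)
    (h : ∀ ⦃T : C⦄ (g : T ⟶ A), g ≫ f = 0 → g = 0) : Mono f := by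
  have : Mono (0 : (0 : C) ⟶ pullback f f) := ⟨fun a b _ => (isZero_zero C).eq_of_tgt a b⟩
  let D : SplitExtension (0 : C) := mk' 0 (pullback.fst f f) (pullback.lift (𝟙 _) (𝟙 _) rfl)
    (pullback.lift_fst _ _ _) zero_comp (fun T t ht => ⟨0, by
      have : t ≫ pullback.snd f f = 0 := h _ (by
        rw [Category.assoc, ← pullback.condition, ← Category.assoc, ht, zero_comp])
      apply pullback.hom_ext <;> simp [ht, this]⟩)
  let d : A ⟶ pullback f f := pullback.lift (𝟙 A) (𝟙 A) rfl
  have hd₁ : d ≫ pullback.fst f f = 𝟙 A := pullback.lift_fst _ _ _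
  have hd₂ : d ≫ pullback.snd f f = 𝟙 A := pullback.lift_snd _ _ _
  have : Mono d := by
    have : Mono (d ≫ pullback.fst f f) := by rw [hd₁]; infer_instance
    exact mono_of_mono _ (pullback.fst f f)
  have : IsIso d := D.isIso_of_mono d 0 (𝟙 A) zero_comp (Category.id_comp _)
  have key : pullback.fst f f = pullback.snd f f := by
    rw [← cancel_epi d, hd₁, hd₂]
  refine ⟨fun a b hab => ?_⟩
  rw [← pullback.lift_fst a b hab, key, pullback.lift_snd]

/-! ### Bourn-normal monomorphisms -/

/-- A monomorphism is Bourn-normal if and only if it is the class of `0` of an internal equivalence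
relation. -/
theorem isBournNormalMono_iff {S Z : C} (m : S ⟶ Z) :
    IsBournNormalMono m ↔ Mono m ∧ ∃ (R : C) (r₁ r₂ : R ⟶ Z), IsEquivalenceRelation r₁ r₂ ∧
      ∀ ⦃T : C⦄ (b : T ⟶ Z), Related r₁ r₂ 0 b ↔ ∃ x, x ≫ m = b := by
  refine and_congr_right fun hm => exists_congr fun R => exists_congr fun r₁ =>
    exists_congr fun r₂ => ⟨?_, ?_⟩
  · rintro ⟨m', hR, h₁, h₂⟩
    refine ⟨hR, fun T b => ⟨?_, ?_⟩⟩
    · rintro ⟨t, ht, rfl⟩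
      have w : t ≫ r₁ = 0 ≫ m := by rw [ht, zero_comp]
      refine ⟨h₁.lift t 0 w ≫ prod.snd, ?_⟩
      rw [Category.assoc, ← h₂.w, ← Category.assoc, h₁.lift_fst]
    · rintro ⟨x, rfl⟩
      refine ⟨prod.lift 0 x ≫ m', ?_, ?_⟩
      · rw [Category.assoc, h₁.w, ← Category.assoc, prod.lift_fst, zero_comp]
      · rw [Category.assoc, h₂.w, ← Category.assoc, prod.lift_snd]
  · rintro ⟨hR, h⟩
    have e := fun T => IsEquivalenceRelation.equivalence_related hR T
    obtain ⟨m', h₁, h₂⟩ : Related r₁ r₂ (prod.fst (X := S) (Y := S) ≫ m) (prod.snd ≫ m) :=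
      (e _).trans ((e _).symm ((h _).2 ⟨_, rfl⟩)) ((h _).2 ⟨_, rfl⟩)
    refine ⟨m', hR, ⟨⟨h₁⟩, ⟨PullbackCone.IsLimit.mk _ (fun s => prod.lift s.snd ?_) ?_ ?_ ?_⟩⟩,
      ⟨⟨h₂⟩, ⟨PullbackCone.IsLimit.mk _ (fun s => prod.lift ?_ s.snd) ?_ ?_ ?_⟩⟩⟩
    · exact ((h _).1 ((e _).trans ((h (s.snd ≫ m)).2 ⟨_, rfl⟩)
        ⟨s.fst, s.condition, rfl⟩)).choose
    · intro s
      have hs := ((h _).1 ((e _).trans ((h (s.snd ≫ m)).2 ⟨_, rfl⟩)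
        ⟨s.fst, s.condition, rfl⟩)).choose_spec
      apply IsEquivalenceRelation.hom_ext hR
      · rw [Category.assoc, h₁, prod.lift_fst_assoc, s.condition]
      · rw [Category.assoc, h₂, prod.lift_snd_assoc, hs]
    · intro s
      exact prod.lift_fst _ _
    · intro s l hl₁ hl₂
      apply prod.hom_ext
      · rw [prod.lift_fst, hl₂]
      · have hs := ((h _).1 ((e _).trans ((h (s.snd ≫ m)).2 ⟨_, rfl⟩)
          ⟨s.fst, s.condition, rfl⟩)).choose_spec
        rw [prod.lift_snd, ← cancel_mono m, hs, Category.assoc, ← h₂, ← hl₁, Category.assoc]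
    · exact ((h _).1 ((e _).trans ((h (s.snd ≫ m)).2 ⟨_, rfl⟩)
        ((e _).symm ⟨s.fst, rfl, s.condition⟩))).choose
    · intro s
      have hs := ((h _).1 ((e _).trans ((h (s.snd ≫ m)).2 ⟨_, rfl⟩)
        ((e _).symm ⟨s.fst, rfl, s.condition⟩))).choose_spec
      apply IsEquivalenceRelation.hom_ext hR
      · rw [Category.assoc, h₁, prod.lift_fst_assoc, hs]
      · rw [Category.assoc, h₂, prod.lift_snd_assoc, s.condition]
    · intro s
      exact prod.lift_snd _ _
    · intro s l hl₁ hl₂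
      apply prod.hom_ext
      · have hs := ((h _).1 ((e _).trans ((h (s.snd ≫ m)).2 ⟨_, rfl⟩)
          ((e _).symm ⟨s.fst, rfl, s.condition⟩))).choose_spec
        rw [prod.lift_fst, ← cancel_mono m, hs, Category.assoc, ← h₁, ← hl₁, Category.assoc]
      · rw [prod.lift_snd, hl₂]

theorem SplitExtension.isBournNormalMono_κ {X : C} (D : SplitExtension X) :
    IsBournNormalMono D.κ := by
  refine (isBournNormalMono_iff _).2 ⟨inferInstance, pullback D.α D.α, pullback.fst _ _,
    pullback.snd _ _, ⟨⟨IsKernelPair.equivalenceRelation D.α _ _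
      (pullback.isLimit _ _) (IsPullback.of_hasPullback D.α D.α)⟩⟩, fun T b => ⟨?_, ?_⟩⟩
  · rintro ⟨t, ht, rfl⟩
    exact D.exists_comp_κ_eq _ (by
      rw [Category.assoc, ← pullback.condition, ← Category.assoc, ht, zero_comp])
  · rintro ⟨x, rfl⟩
    exact ⟨pullback.lift 0 (x ≫ D.κ) (by rw [zero_comp, Category.assoc, D.κ_comp, comp_zero]),
      pullback.lift_fst _ _ _, pullback.lift_snd _ _ _⟩

omit [HasFiniteLimits C] in
/-- An equivalence relation whose class of `0` is a monomorphism `m : S ⟶ Z`, as a split extension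
with kernel `S` over `Z`: the split epimorphism is the first projection, and the section is the
diagonal. -/
theorem exists_relExtension {S Z R : C} {m : S ⟶ Z} [Mono m] {r₁ r₂ : R ⟶ Z}
    (hR : IsEquivalenceRelation r₁ r₂)
    (h : ∀ ⦃T : C⦄ (b : T ⟶ Z), Related r₁ r₂ 0 b ↔ ∃ x, x ≫ m = b) :
    ∃ (k : S ⟶ R) (s : Z ⟶ R) (_ : s ≫ r₁ = 𝟙 Z) (w : k ≫ r₁ = 0),
      s ≫ r₂ = 𝟙 Z ∧ k ≫ r₂ = m ∧ Nonempty (IsLimit (KernelFork.ofι k w)) := by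
  obtain ⟨k, hk₁, hk₂⟩ := (h m).2 ⟨𝟙 _, Category.id_comp _⟩
  obtain ⟨s, hs₁, hs₂⟩ := (IsEquivalenceRelation.equivalence_related hR Z).refl (𝟙 Z)
  have : Mono k := by
    have : Mono (k ≫ r₂) := hk₂ ▸ inferInstance
    exact mono_of_mono k r₂
  refine ⟨k, s, hs₁, hk₁, hs₂, hk₂, (mk' k r₁ s hs₁ hk₁ fun T f hf => ?_).isKernel⟩
  obtain ⟨x, hx⟩ := (h (f ≫ r₂)).1 ⟨f, hf, rfl⟩
  refine ⟨x, IsEquivalenceRelation.hom_ext hR ?_ ?_⟩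
  · rw [Category.assoc, hk₁, comp_zero, hf]
  · rw [Category.assoc, hk₂, hx]

/-! ### Classifying morphisms and the action of the generic split extension -/

section Generic

variable {X : C} {E : SplitExtension X} (hE : IsGeneric E)

/-- The base component of the unique morphism to the generic split extension. -/
def classify (D : SplitExtension X) : D.base ⟶ E.base := baseMap (hE.from D)

omit [HasFiniteLimits C] in
theorem baseMap_comp_classify {D D' : SplitExtension X} (f : D ⟶ D') :
    baseMap f ≫ classify hE D' = classify hE D :=
  congrArg baseMap (hE.hom_ext (f ≫ hE.from D') (hE.from D))

omit [HasFiniteLimits C] in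
theorem baseMap_eq_classify {D : SplitExtension X} (f : D ⟶ E) : baseMap f = classify hE D :=
  congrArg baseMap (hE.hom_ext f (hE.from D))

omit [HasFiniteLimits C] in
theorem midMap_eq_midMap_from {D : SplitExtension X} (f : D ⟶ E) :
    midMap f = midMap (hE.from D) :=
  congrArg midMap (hE.hom_ext f (hE.from D))

/-- The second projection `[X] ⋉ X ⟶ [X]`. For groups, it sends the product `x * a` of an
element `x` and an automorphism `a` to the automorphism `a` followed by conjugation by `x`. -/
def secondProj : E.mid ⟶ E.base := classify hE E.kernelPairExtension

/-- Changing the section of a split extension alters its classifying morphism through the second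
projection. -/
theorem classify_changeSection (D : SplitExtension X) (σ : D.base ⟶ D.mid)
    (hσ : σ ≫ D.α = 𝟙 D.base) :
    classify hE (D.changeSection σ hσ) = σ ≫ midMap (hE.from D) ≫ secondProj hE := by
  let v : D.mid ⟶ E.mid := midMap (hE.from D)
  have hv : D.κ ≫ v = E.κ := κ_midMap _
  have w : v ≫ E.α = (D.α ≫ σ ≫ v) ≫ E.α := by
    simp only [v, Category.assoc, midMap_α, reassoc_of% hσ]
  let f : D.changeSection σ hσ ⟶ E.kernelPairExtension :=
    homMk (pullback.lift v (D.α ≫ σ ≫ v) w) (σ ≫ v)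
      (by
        apply pullback.hom_ext
        · simp only [Category.assoc, pullback.lift_fst, hv]
        · simp only [Category.assoc, pullback.lift_snd, reassoc_of% D.κ_comp, zero_comp])
      (by
        apply pullback.hom_ext <;>
          simp only [Category.assoc, pullback.lift_fst, pullback.lift_snd, Category.comp_id,
            reassoc_of% hσ])
      (pullback.lift_snd _ _ _)
  rw [← baseMap_comp_classify hE f]
  exact Category.assoc _ _ _

theorem β_comp_secondProj : E.β ≫ secondProj hE = 𝟙 E.base := by
  have h := classify_changeSection hE E E.β E.section_comp
  rw [← midMap_eq_midMap_from hE (𝟙 E)] at h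
  have h₁ : classify hE E = 𝟙 E.base := (baseMap_eq_classify hE (𝟙 E)).symm
  have h₂ : midMap (𝟙 E) = 𝟙 E.mid := rfl
  rw [h₂, Category.id_comp] at h
  exact h.symm.trans h₁

theorem κ_comp_secondProj : E.κ ≫ secondProj hE = conj hE := by
  have w : (prod.snd (X := X) (Y := X) ≫ E.κ) ≫ E.α = (prod.fst ≫ E.κ) ≫ E.α := by
    simp [E.κ_comp]
  have w' : E.κ ≫ E.α = 0 ≫ E.α := by rw [E.κ_comp, zero_comp]
  have h₁ : prod.lift 0 (𝟙 X) ≫ pullback.lift (prod.snd ≫ E.κ) (prod.fst ≫ E.κ) w =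
      pullback.lift E.κ 0 w' := by
    apply pullback.hom_ext <;>
      simp only [Category.assoc, pullback.lift_fst, pullback.lift_snd, prod.lift_fst_assoc,
        prod.lift_snd_assoc, zero_comp, Category.id_comp]
  have h₂ : prod.lift (𝟙 X) (𝟙 X) ≫ pullback.lift (prod.snd ≫ E.κ) (prod.fst ≫ E.κ) w =
      E.κ ≫ pullback.lift (𝟙 _) (𝟙 _) rfl := by
    apply pullback.hom_ext <;>
      simp only [Category.assoc, pullback.lift_fst, pullback.lift_snd, prod.lift_fst_assoc,
        prod.lift_snd_assoc, Category.comp_id, Category.id_comp]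
  exact baseMap_comp_classify hE (D := conjExtension X) (D' := E.kernelPairExtension)
    (homMk (D := conjExtension X) (D' := E.kernelPairExtension) _ E.κ h₁ h₂
      (pullback.lift_snd _ _ _))

/-- Two sections of one split extension yield related classifying morphisms, so the relation
defined by the generic split extension is Euclidean. -/
theorem related_of_related_of_related {T : C} {a b c : T ⟶ E.base}
    (h₁ : Related E.α (secondProj hE) b a) (h₂ : Related E.α (secondProj hE) b c) :
    Related E.α (secondProj hE) a c := by
  obtain ⟨g₁, rfl, rfl⟩ := h₁
  obtain ⟨g₂, h, rfl⟩ := h₂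
  let D := E.pullbackAlong (g₁ ≫ E.α)
  let σ₁ : D.base ⟶ D.mid := pullback.lift g₁ (𝟙 T) (Category.id_comp _).symm
  let σ₂ : D.base ⟶ D.mid := pullback.lift g₂ (𝟙 T) (h.trans (Category.id_comp _).symm)
  have hσ₁ : σ₁ ≫ D.α = 𝟙 D.base := pullback.lift_snd _ _ _
  have hσ₂ : σ₂ ≫ D.α = 𝟙 D.base := pullback.lift_snd _ _ _
  have hD : midMap (hE.from D) = pullback.fst E.α (g₁ ≫ E.α) :=
    (midMap_eq_midMap_from hE (E.pullbackProj (g₁ ≫ E.α))).symm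
  have hσ₁' : σ₁ ≫ midMap (hE.from D) = g₁ := by rw [hD]; exact pullback.lift_fst _ _ _
  have hσ₂' : σ₂ ≫ midMap (hE.from D) = g₂ := by rw [hD]; exact pullback.lift_fst _ _ _
  have hc₁ := classify_changeSection hE D σ₁ hσ₁
  have hc₂ := classify_changeSection hE D σ₂ hσ₂
  rw [reassoc_of% hσ₁'] at hc₁
  rw [reassoc_of% hσ₂'] at hc₂
  let D₁ := D.changeSection σ₁ hσ₁
  have hc₃ : classify hE (D.changeSection σ₂ hσ₂) = σ₂ ≫ midMap (D := D₁) (hE.from D₁) ≫ secondProj hE :=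
    classify_changeSection hE D₁ σ₂ hσ₂
  have hα : midMap (D := D₁) (hE.from D₁) ≫ E.α = D.α ≫ classify hE D₁ := midMap_α (hE.from D₁)
  refine ⟨σ₂ ≫ midMap (D := D₁) (hE.from D₁), ?_, ?_⟩
  · have hc₁' : classify hE D₁ = g₁ ≫ secondProj hE := hc₁
    refine (Category.assoc _ _ _).trans ((congrArg (σ₂ ≫ ·) hα).trans ?_)
    refine (Category.assoc _ _ _).symm.trans ?_
    refine (congrArg (· ≫ classify hE D₁) hσ₂).trans ?_
    exact (Category.id_comp _).trans hc₁'
  · exact (Category.assoc _ _ _).trans (hc₃.symm.trans hc₂)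

theorem equivalence_related_secondProj (T : C) :
    Equivalence (Related (T := T) E.α (secondProj hE)) := by
  have hrefl : ∀ a : T ⟶ E.base, Related E.α (secondProj hE) a a := fun a =>
    ⟨a ≫ E.β, by simp [E.section_comp], by simp [β_comp_secondProj]⟩
  have hsymm : ∀ {a b : T ⟶ E.base}, Related E.α (secondProj hE) a b →
      Related E.α (secondProj hE) b a := fun h =>
    related_of_related_of_related hE h (hrefl _)
  exact ⟨hrefl, hsymm, fun h h' => related_of_related_of_related hE (hsymm h) h'⟩

theorem related_zero_iff {T : C} (b : T ⟶ E.base) :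
    Related E.α (secondProj hE) 0 b ↔ ∃ x, x ≫ conj hE = b := by
  constructor
  · rintro ⟨t, ht, rfl⟩
    obtain ⟨x, rfl⟩ := E.exists_comp_κ_eq t ht
    exact ⟨x, by rw [Category.assoc, κ_comp_secondProj]⟩
  · rintro ⟨x, rfl⟩
    exact ⟨x ≫ E.κ, by simp [E.κ_comp], by simp [κ_comp_secondProj]⟩

/-! ### Trivial center -/

/-- A morphism commutes with the identity of `X` if and only if the conjugation morphism annihilates
it. -/
theorem huqCommute_id_iff [IsProtomodular C] {B : C} (g : B ⟶ X) :
    HuqCommute (𝟙 X) g ↔ g ≫ conj hE = 0 := by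
  have hmono : Mono (prod.lift (0 : X ⟶ B) (𝟙 X)) := by
    have : Mono (prod.lift (0 : X ⟶ B) (𝟙 X) ≫ prod.snd) := by
      rw [prod.lift_snd]; infer_instance
    exact mono_of_mono _ (prod.snd : B ⨯ X ⟶ X)
  have hker : ∀ ⦃T : C⦄ (f : T ⟶ B ⨯ X), f ≫ prod.fst = 0 →
      ∃ x, x ≫ prod.lift (0 : X ⟶ B) (𝟙 X) = f := fun T f hf =>
    ⟨f ≫ prod.snd, by
      apply prod.hom_ext
      · rw [Category.assoc, prod.lift_fst, comp_zero, hf]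
      · rw [Category.assoc, prod.lift_snd, Category.comp_id]⟩
  -- The trivial split extension over `B`, and the one with section `⟨1, g⟩`.
  let D₀ : SplitExtension X := mk' (prod.lift 0 (𝟙 X)) prod.fst (prod.lift (𝟙 B) 0)
    (prod.lift_fst _ _) (prod.lift_fst _ _) hker
  let D₁ : SplitExtension X := mk' (prod.lift 0 (𝟙 X)) prod.fst (prod.lift (𝟙 B) g)
    (prod.lift_fst _ _) (prod.lift_fst _ _) hker
  have h₁ : g ≫ conj hE = classify hE D₁ := by
    have e₁ : prod.lift (0 : X ⟶ B) (𝟙 X) ≫ prod.map g (𝟙 X) = prod.lift 0 (𝟙 X) := by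
      rw [prod.lift_map, zero_comp, Category.comp_id]
    have e₂ : prod.lift (𝟙 B) g ≫ prod.map g (𝟙 X) = g ≫ prod.lift (𝟙 X) (𝟙 X) := by
      rw [prod.lift_map, prod.comp_lift, Category.id_comp, Category.comp_id]
    exact baseMap_comp_classify hE (D := D₁) (D' := conjExtension X)
      (homMk (D := D₁) (D' := conjExtension X) (prod.map g (𝟙 X)) g e₁ e₂ (prod.map_fst _ _))
  have h₀ : classify hE D₀ = 0 := by
    have e₁ : prod.lift (0 : X ⟶ B) (𝟙 X) ≫ prod.snd ≫ E.κ = E.κ := by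
      rw [prod.lift_snd_assoc, Category.id_comp]
    have e₂ : prod.lift (𝟙 B) (0 : B ⟶ X) ≫ prod.snd ≫ E.κ = 0 ≫ E.β := by
      rw [prod.lift_snd_assoc, zero_comp, zero_comp]
    have e₃ : (prod.snd ≫ E.κ) ≫ E.α = (prod.fst : B ⨯ X ⟶ B) ≫ 0 := by
      rw [Category.assoc, E.κ_comp, comp_zero, comp_zero]
    exact (baseMap_eq_classify hE (homMk (D := D₀) (D' := E) (prod.snd ≫ E.κ) 0 e₁ e₂ e₃)).symm
  constructor
  · rintro ⟨φ, hφ₁, hφ₂⟩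
    have e₁ : prod.lift (0 : X ⟶ B) (𝟙 X) ≫ prod.lift prod.fst (prod.lift prod.snd prod.fst ≫ φ) =
        prod.lift 0 (𝟙 X) := by
      apply prod.hom_ext
      · rw [Category.assoc, prod.lift_fst, prod.lift_fst]
      · rw [Category.assoc, prod.lift_snd, prod.lift_snd, ← Category.assoc, prod.comp_lift,
          prod.lift_fst, prod.lift_snd, hφ₁]
    have e₂ : prod.lift (𝟙 B) (0 : B ⟶ X) ≫ prod.lift prod.fst (prod.lift prod.snd prod.fst ≫ φ) =
        𝟙 B ≫ prod.lift (𝟙 B) g := by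
      rw [Category.id_comp]
      apply prod.hom_ext
      · rw [Category.assoc, prod.lift_fst, prod.lift_fst, prod.lift_fst]
      · rw [Category.assoc, prod.lift_snd, prod.lift_snd, ← Category.assoc, prod.comp_lift,
          prod.lift_fst, prod.lift_snd, hφ₂]
    have h := baseMap_comp_classify hE (homMk (D := D₀) (D' := D₁)
      (prod.lift prod.fst (prod.lift prod.snd prod.fst ≫ φ)) (𝟙 B) e₁ e₂
      ((prod.lift_fst _ _).trans (Category.comp_id _).symm))
    rw [h₁, ← h₀, ← h]
    exact (Category.id_comp _).symm
  · intro hg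
    rw [h₁] at hg
    -- The classifying morphism of `D₁` is `0`, so `D₁` maps to the kernel of `E.α`.
    obtain ⟨ψ, hψ⟩ := E.exists_comp_κ_eq (midMap (hE.from D₁)) (by
      rw [midMap_α]
      exact (congrArg (D₁.α ≫ ·) hg).trans comp_zero)
    have hψ₁ : prod.lift (0 : X ⟶ B) (𝟙 X) ≫ ψ = 𝟙 X := by
      rw [← cancel_mono E.κ, Category.assoc, hψ, Category.id_comp]
      exact κ_midMap (hE.from D₁)
    have hψ₂ : prod.lift (𝟙 B) g ≫ ψ = 0 := by
      rw [← cancel_mono E.κ, Category.assoc, hψ, zero_comp]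
      refine (β_midMap (hE.from D₁)).trans ?_
      exact (congrArg (· ≫ E.β) hg).trans zero_comp
    let q : B ⨯ X ⟶ B ⨯ X := prod.lift prod.fst ψ
    have e₁ : prod.lift (0 : X ⟶ B) (𝟙 X) ≫ q = prod.lift 0 (𝟙 X) := by
      rw [prod.comp_lift, prod.lift_fst, hψ₁]
    have e₂ : prod.lift (𝟙 B) g ≫ q = prod.lift (𝟙 B) 0 := by
      rw [prod.comp_lift, prod.lift_fst, hψ₂]
    let f : HomOver D₁ D₀ (𝟙 X) := homMk (D := D₁) (D' := D₀) q (𝟙 B) e₁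
      (e₂.trans (Category.id_comp _).symm) ((prod.lift_fst _ _).trans (Category.comp_id _).symm)
    have : IsIso q := IsProtomodular.isIso_mid f inferInstance (inferInstanceAs (IsIso (𝟙 B)))
    -- The inverse of `q` carries the section `⟨1, 0⟩` to `⟨1, g⟩`.
    refine ⟨prod.lift prod.snd prod.fst ≫ inv q ≫ prod.snd, ?_, ?_⟩
    · have : prod.lift (0 : X ⟶ B) (𝟙 X) ≫ inv q = prod.lift 0 (𝟙 X) := by
        rw [IsIso.comp_inv_eq, e₁]
      rw [← Category.assoc, prod.comp_lift, prod.lift_fst, prod.lift_snd, reassoc_of% this,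
        prod.lift_snd]
    · have : prod.lift (𝟙 B) (0 : B ⟶ X) ≫ inv q = prod.lift (𝟙 B) g := by
        rw [IsIso.comp_inv_eq, e₂]
      rw [← Category.assoc, prod.comp_lift, prod.lift_fst, prod.lift_snd, reassoc_of% this,
        prod.lift_snd]

theorem hasTrivialCenter_iff_mono_conj [HasZeroObject C] [IsProtomodular C] :
    HasTrivialCenter X ↔ Mono (conj hE) := by
  constructor
  · rintro ⟨z, ⟨hz⟩, h₀⟩
    refine mono_of_comp_eq_zero _ fun T g hg => ?_
    let y : CommutingWith (𝟙 X) := ⟨Over.mk g, (huqCommute_id_iff hE g).2 hg⟩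
    have := Over.w (hz.from y).hom
    exact this.symm.trans (by rw [h₀.eq_of_tgt (hz.from y).hom.left 0, zero_comp])
  · intro hc
    refine ⟨⟨Over.mk (0 : (0 : C) ⟶ X), (huqCommute_id_iff hE _).2 zero_comp⟩, ⟨?_⟩, isZero_zero C⟩
    refine IsTerminal.ofUniqueHom (fun y => ⟨Over.homMk 0 ?_⟩) fun y f => ?_
    · have hy := (huqCommute_id_iff hE y.obj.hom).1 y.property
      have : y.obj.hom = 0 := by rw [← cancel_mono (conj hE), hy, zero_comp]
      exact zero_comp.trans this.symm
    · ext
      exact (isZero_zero C).eq_of_tgt _ _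

/-! ### The case of a monomorphic conjugation morphism -/

section Mono

variable [IsProtomodular C]

theorem mono_lift_secondProj [HasZeroObject C] [Mono (conj hE)] :
    Mono (prod.lift E.α (secondProj hE)) := by
  refine mono_of_comp_eq_zero _ fun T g hg => ?_
  have h₁ : g ≫ E.α = 0 := by
    rw [← prod.lift_fst E.α (secondProj hE), ← Category.assoc, hg, zero_comp]
  have h₂ : g ≫ secondProj hE = 0 := by
    rw [← prod.lift_snd E.α (secondProj hE), ← Category.assoc, hg, zero_comp]
  obtain ⟨x, rfl⟩ := E.exists_comp_κ_eq g h₁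
  rw [Category.assoc, κ_comp_secondProj] at h₂
  rw [show x = 0 by rw [← cancel_mono (conj hE), h₂, zero_comp], zero_comp]

/-- If `X` has trivial center, a morphism `q` that restricts to the conjugation morphism on the
kernel of `D` determines the classifying morphism of `D`. For groups: if `q` extends
`X → Aut X`, then `b` acts on `X` as the automorphism `q b`. -/
theorem classify_eq_of_κ_comp [HasZeroObject C] [Mono (conj hE)] (D : SplitExtension X)
    (q : D.mid ⟶ E.base) (hq : D.κ ≫ q = conj hE) : classify hE D = D.β ≫ q := by
  have := mono_lift_secondProj hE
  let p := prod.lift E.α (secondProj hE)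
  let r : D.mid ⟶ E.base ⨯ E.base := prod.lift (D.α ≫ D.β ≫ q) q
  have hκ : D.κ ≫ r = E.κ ≫ p := by
    rw [prod.comp_lift, prod.comp_lift, hq, κ_comp_secondProj, E.κ_comp, reassoc_of% D.κ_comp,
      zero_comp]
  have hβ : D.β ≫ r = (D.β ≫ q) ≫ E.β ≫ p := by
    rw [prod.comp_lift, prod.comp_lift, reassoc_of% D.section_comp, E.section_comp,
      β_comp_secondProj, prod.comp_lift, Category.comp_id]
  -- The inverse image along `r` of the relation contains the kernel and the section of `D`.
  have : IsIso (pullback.fst r p) := D.isIso_of_mono (pullback.fst r p)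
    (pullback.lift D.κ E.κ hκ)
    (pullback.lift D.β ((D.β ≫ q) ≫ E.β) (hβ.trans (Category.assoc _ _ _).symm))
    (pullback.lift_fst _ _ _) (pullback.lift_fst _ _ _)
  obtain ⟨v, hv⟩ : ∃ v, v ≫ p = r :=
    ⟨inv (pullback.fst r p) ≫ pullback.snd r p, by
      rw [Category.assoc, ← pullback.condition, IsIso.inv_hom_id_assoc]⟩
  refine (baseMap_eq_classify hE (homMk v (D.β ≫ q) ?_ ?_ ?_)).symm
  · rw [← cancel_mono p, Category.assoc, hv, hκ]
  · rw [← cancel_mono p, Category.assoc, hv, hβ, Category.assoc (D.β ≫ q)]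
  · have : v ≫ p ≫ prod.fst = r ≫ prod.fst := by rw [← Category.assoc, hv]
    rwa [prod.lift_fst, prod.lift_fst] at this

/-- If the conjugation morphism is a characteristic monomorphism, then `[X]` is strong-complete. -/
theorem isStrongComplete_of_isCharacteristicMono [HasZeroObject C] [Mono (conj hE)]
    (hc : IsCharacteristicMono (conj hE)) : IsStrongComplete E.base := by
  rintro A κ ⟨B, α, w, hα, ⟨hκ⟩⟩
  let F : SplitExtension E.base := ⟨A, B, κ, α, section_ α, IsSplitEpi.id α, w, ⟨hκ⟩⟩
  obtain ⟨_, R, r₁, r₂, hR, h₀⟩ := (isBournNormalMono_iff _).1 (hc κ F.isBournNormalMono_κ)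
  obtain ⟨k, s, hs₁, hk₁, hs₂, hk₂, hk⟩ := exists_relExtension hR h₀
  let D : SplitExtension X := ⟨R, A, k, r₁, s, hs₁, hk₁, hk⟩
  have hκD : ∀ r : A ⟶ E.base, κ ≫ r = 𝟙 _ → r = classify hE D := fun r hr => by
    have hq : D.κ ≫ r₂ ≫ r = conj hE := by
      change k ≫ r₂ ≫ r = _
      rw [reassoc_of% hk₂, hr, Category.comp_id]
    refine Eq.trans ?_ (classify_eq_of_κ_comp hE D (r₂ ≫ r) hq).symm
    change r = s ≫ r₂ ≫ r
    rw [reassoc_of% hs₂]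
  refine ⟨classify hE D, ?_, hκD⟩
  -- The restriction of the second projection of `R` to pairs whose first member lies in `[X]`
  -- takes its values in `[X]` as well.
  let D' := D.pullbackAlong κ
  let π : D'.mid ⟶ R := pullback.fst r₁ κ
  have hκ' : D'.κ ≫ π = k := pullback.lift_fst _ _ _
  have hβ' : D'.β ≫ π = κ ≫ s := pullback.lift_fst _ _ _
  obtain ⟨q, hq⟩ : ∃ q, q ≫ κ = π ≫ r₂ := F.exists_comp_κ_eq (π ≫ r₂) (by
    apply D'.mid_hom_ext
    · rw [comp_zero]
      change D'.κ ≫ (π ≫ r₂) ≫ α = 0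
      rw [Category.assoc, reassoc_of% hκ', reassoc_of% hk₂, w, comp_zero]
    · rw [comp_zero]
      change D'.β ≫ (π ≫ r₂) ≫ α = 0
      rw [Category.assoc, reassoc_of% hβ', reassoc_of% hs₂, w])
  have hκ_mono : Mono κ := F.mono_κ
  have hq₁ : D'.κ ≫ q = conj hE := by
    rw [← cancel_mono κ, Category.assoc, hq, reassoc_of% hκ', hk₂]
  have hq₂ : D'.β ≫ q = 𝟙 E.base := by
    rw [← cancel_mono κ, Category.assoc, hq, reassoc_of% hβ', hs₂, Category.comp_id]
    exact (Category.id_comp _).symm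
  exact (baseMap_comp_classify hE (D.pullbackProj κ)).trans
    ((classify_eq_of_κ_comp hE D' q hq₁).trans hq₂)

end Mono

end Generic

/-! ### Strong-complete objects and characteristic conjugation morphisms -/

/-- If `Y` is strong-complete, then its conjugation extension is a generic split extension with
kernel `Y`: morphisms to it over `Y` correspond to retractions of the kernel inclusion. -/
theorem nonempty_isGeneric_conjExtension {Y : C} (hY : IsStrongComplete Y) :
    Nonempty (IsGeneric (conjExtension Y)) := by
  have h : ∀ D : SplitExtension Y, ∃! r : D.mid ⟶ Y, D.κ ≫ r = 𝟙 Y := fun D =>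
    hY D.κ ⟨D.base, D.α, D.κ_comp, ⟨⟨D.β, D.section_comp⟩⟩, D.isKernel⟩
  choose r hr hr' using h
  have e₁ (D : SplitExtension Y) : D.κ ≫ prod.lift (D.α ≫ D.β ≫ r D) (r D) = prod.lift 0 (𝟙 Y) := by
    rw [prod.comp_lift, reassoc_of% D.κ_comp, zero_comp, hr]
  have e₂ (D : SplitExtension Y) : D.β ≫ prod.lift (D.α ≫ D.β ≫ r D) (r D) =
      (D.β ≫ r D) ≫ prod.lift (𝟙 Y) (𝟙 Y) := by
    rw [prod.comp_lift, prod.comp_lift, reassoc_of% D.section_comp, Category.comp_id]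
  refine ⟨IsTerminal.ofUniqueHom (fun D => homMk (D' := conjExtension Y)
    (prod.lift (D.α ≫ D.β ≫ r D) (r D)) (D.β ≫ r D) (e₁ D) (e₂ D) (prod.lift_fst _ _)) ?_⟩
  intro D f
  obtain ⟨v, hv⟩ : ∃ v : D.mid ⟶ Y ⨯ Y, v = midMap f := ⟨_, rfl⟩
  obtain ⟨b, hb⟩ : ∃ b : D.base ⟶ Y, b = baseMap f := ⟨_, rfl⟩
  have hκ : D.κ ≫ v = prod.lift 0 (𝟙 Y) := by rw [hv]; exact κ_midMap f
  have hβ : D.β ≫ v = b ≫ prod.lift (𝟙 Y) (𝟙 Y) := by rw [hv, hb]; exact β_midMap f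
  have hα : v ≫ prod.fst = D.α ≫ b := by rw [hv, hb]; exact midMap_α f
  have h₁ : v ≫ prod.snd = r D := hr' D _ (by
    change D.κ ≫ v ≫ prod.snd = _
    rw [reassoc_of% hκ, prod.lift_snd])
  have h₂ : b = D.β ≫ r D := by
    rw [← h₁, reassoc_of% hβ, prod.lift_snd, Category.comp_id]
  have h₃ : v = prod.lift (D.α ≫ D.β ≫ r D) (r D) := by
    apply prod.hom_ext
    · rw [hα, h₂, prod.lift_fst]
    · rw [h₁, prod.lift_snd]
  exact HomOver.ext (hv.symm.trans h₃) (hb.symm.trans h₂)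

/-- If `X` has trivial center and `[X]` is strong-complete, then the conjugation morphism is a
characteristic monomorphism. -/
theorem isCharacteristicMono_conj [HasZeroObject C] [IsProtomodular C] {X : C}
    {E : SplitExtension X} (hE : IsGeneric E) [Mono (conj hE)] (hY : IsStrongComplete E.base) :
    IsCharacteristicMono (conj hE) := by
  intro Z n hn
  obtain ⟨_, R, r₁, r₂, hR, h₀⟩ := (isBournNormalMono_iff n).1 hn
  obtain ⟨w, hw⟩ : ∃ w : Z ⟶ E.base, n ≫ w = 𝟙 _ := by
    obtain ⟨k, s, hs₁, hk₁, hs₂, hk₂, hk⟩ := exists_relExtension hR h₀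
    let D : SplitExtension E.base := ⟨R, Z, k, r₁, s, hs₁, hk₁, hk⟩
    obtain ⟨hT⟩ := nonempty_isGeneric_conjExtension hY
    have e := IsEquivalenceRelation.equivalence_related hR (E.base ⨯ E.base)
    obtain ⟨m', h₁, h₂⟩ : Related r₁ r₂ (prod.fst (X := E.base) (Y := E.base) ≫ n)
        (prod.snd ≫ n) :=
      e.trans (e.symm ((h₀ _).2 ⟨_, rfl⟩)) ((h₀ _).2 ⟨_, rfl⟩)
    have e₁ : prod.lift 0 (𝟙 E.base) ≫ m' = k := by
      apply IsEquivalenceRelation.hom_ext hR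
      · rw [Category.assoc, h₁, prod.lift_fst_assoc, zero_comp, hk₁]
      · rw [Category.assoc, h₂, prod.lift_snd_assoc, Category.id_comp, hk₂]
    have e₂ : prod.lift (𝟙 E.base) (𝟙 E.base) ≫ m' = n ≫ s := by
      apply IsEquivalenceRelation.hom_ext hR
      · rw [Category.assoc, h₁, prod.lift_fst_assoc, Category.id_comp, Category.assoc, hs₁,
          Category.comp_id]
      · rw [Category.assoc, h₂, prod.lift_snd_assoc, Category.id_comp, Category.assoc, hs₂,
          Category.comp_id]
    let f : conjExtension E.base ⟶ D :=
      homMk (D := conjExtension E.base) (D' := D) m' n e₁ e₂ h₁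
    refine ⟨baseMap (hT.from D), ?_⟩
    exact congrArg baseMap (hT.hom_ext (f ≫ hT.from D) (𝟙 _))
  -- The intersection of `R` with the inverse image along `w` of the relation on `[X]`.
  have hp := mono_lift_secondProj hE
  let p := prod.lift E.α (secondProj hE)
  let ρ : R ⟶ E.base ⨯ E.base := prod.lift (r₁ ≫ w) (r₂ ≫ w)
  let Q := pullback ρ p
  let j : Q ⟶ R := pullback.fst ρ p
  have hrel {T : C} (a b : T ⟶ Z) : Related (j ≫ r₁) (j ≫ r₂) a b ↔
      Related r₁ r₂ a b ∧ Related E.α (secondProj hE) (a ≫ w) (b ≫ w) := by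
    constructor
    · rintro ⟨t, rfl, rfl⟩
      refine ⟨⟨t ≫ j, by rw [Category.assoc], by rw [Category.assoc]⟩,
        t ≫ pullback.snd ρ p, ?_, ?_⟩
      · have : pullback.snd ρ p ≫ E.α = j ≫ r₁ ≫ w := by
          have := congrArg (· ≫ prod.fst) (pullback.condition (f := ρ) (g := p))
          simpa only [Category.assoc, ρ, p, prod.lift_fst] using this.symm
        simp only [Category.assoc, this]
      · have : pullback.snd ρ p ≫ secondProj hE = j ≫ r₂ ≫ w := by
          have := congrArg (· ≫ prod.snd) (pullback.condition (f := ρ) (g := p))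
          simpa only [Category.assoc, ρ, p, prod.lift_snd] using this.symm
        simp only [Category.assoc, this]
    · rintro ⟨⟨t, rfl, rfl⟩, g, hg₁, hg₂⟩
      have : t ≫ ρ = g ≫ p := by
        rw [prod.comp_lift, prod.comp_lift, hg₁, hg₂, Category.assoc, Category.assoc]
      have hj : pullback.lift t g this ≫ j = t := pullback.lift_fst _ _ _
      exact ⟨pullback.lift t g this, by rw [reassoc_of% hj], by rw [reassoc_of% hj]⟩
  refine (isBournNormalMono_iff _).2 ⟨inferInstance, Q, j ≫ r₁, j ≫ r₂, ?_, fun T b => ?_⟩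
  · refine isEquivalenceRelation_of_equivalence_related (fun T f g h₁ h₂ => ?_) fun T => ?_
    · rw [← cancel_mono j]
      apply IsEquivalenceRelation.hom_ext hR <;> simpa only [Category.assoc]
    · have e₁ := IsEquivalenceRelation.equivalence_related hR T
      have e₂ := equivalence_related_secondProj hE T
      exact ⟨fun a => (hrel _ _).2 ⟨e₁.refl _, e₂.refl _⟩,
        fun h => (hrel _ _).2 ⟨e₁.symm ((hrel _ _).1 h).1, e₂.symm ((hrel _ _).1 h).2⟩,
        fun h h' => (hrel _ _).2 ⟨e₁.trans ((hrel _ _).1 h).1 ((hrel _ _).1 h').1,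
          e₂.trans ((hrel _ _).1 h).2 ((hrel _ _).1 h').2⟩⟩
  · rw [hrel, h₀, zero_comp, related_zero_iff]
    constructor
    · rintro ⟨⟨y, rfl⟩, x, hx⟩
      rw [Category.assoc, hw, Category.comp_id] at hx
      exact ⟨x, by rw [← hx, Category.assoc]⟩
    · rintro ⟨x, rfl⟩
      exact ⟨⟨x ≫ conj hE, Category.assoc _ _ _⟩,
        x, by rw [Category.assoc, Category.assoc, hw, Category.comp_id]⟩

theorem isBournNormalMono_id [HasZeroObject C] (Y : C) : IsBournNormalMono (𝟙 Y) := by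
  let D : SplitExtension Y := mk' (𝟙 Y) (0 : Y ⟶ (0 : C)) 0
    ((isZero_zero C).eq_of_tgt _ _) comp_zero fun T f _ => ⟨f, Category.comp_id f⟩
  exact D.isBournNormalMono_κ

end

end PointedCat

theorem mainTheorem4 {C : Type u} [Category.{v} C] [HasZeroObject C] [HasZeroMorphisms C]
    [HasFiniteLimits C] [PointedCat.IsProtomodular C] (X : C)
    (E : PointedCat.SplitExtension X) (hE : PointedCat.IsGeneric E) :
    ((∃ F : PointedCat.SplitExtension E.base, Nonempty (PointedCat.IsGeneric F)) ∧
        PointedCat.IsCharacteristicMono (PointedCat.conj hE)) ↔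
      (PointedCat.HasTrivialCenter X ∧ PointedCat.IsStrongComplete E.base) := by
  rw [PointedCat.hasTrivialCenter_iff_mono_conj hE]
  constructor
  · rintro ⟨-, hc⟩
    have : Mono (PointedCat.conj hE) := by
      have h := (hc _ (PointedCat.isBournNormalMono_id E.base)).1
      rwa [Category.comp_id] at h
    exact ⟨this, PointedCat.isStrongComplete_of_isCharacteristicMono hE hc⟩
  · rintro ⟨hm, hY⟩
    exact ⟨⟨_, PointedCat.nonempty_isGeneric_conjExtension hY⟩,
      PointedCat.isCharacteristicMono_conj hE hY⟩
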